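/- **Setting.** Let $M\ge 3$ be odd, $N=(M-1)/2$, $0<\chi\le 1$ and $\hat\chi=\dfrac{2\chi}{(2-\chi)\sqrt{2\pi}}$. Let $\phi_k$ be the orthonormal Hermite polynomials for the Gaussian weight $\omega(\xi)=(2\pi)^{-1/2}e^{-\xi^2/2}$, and let $S_c$ be the $(N+1)\times(N+1)$ matrix with entries $\frac{\sqrt{2\pi}}{2}\int_{\mathbb R}|\xi|\,\phi_k\phi_l\,\omega\,d\xi$, $k,l\in\{0,2,\dots,M-1\}$. Let $g=(\sqrt2,0,\dots,0)^T\in\mathbb R^N$, and let $\hat M$ be the lower bidiagonal $N\times N$ matrix with diagonal $\sqrt3,\sqrt5,\dots,\sqrt M$ and subdiagonal $\sqrt4,\sqrt6,\dots,\sqrt{M-1}$. Fix an orthogonal matrix $R=\begin{pmatrix}R_e&R_e\\R_o&-R_o\end{pmatrix}$ (one exists) and a positive diagonal matrix $\Lambda_+$ with $$\begin{pmatrix}0&\hat M\\ \hat M^T&0\end{pmatrix}R=R\begin{pmatrix}\Lambda_+&0\\0&-\Lambda_+\end{pmatrix},$$ and put $$H_M=\hat\chi S_c\begin{pmatrix}1&-g^TR_e\\0&R_e\end{pmatrix}+\begin{pmatrix}0&0\\0&\hat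 MR_o\end{pmatrix},\quad K_M=(1,0)H_M^{-1}\begin{pmatrix}1\\g\end{pmatrix},\quad J_M=-(1,0)H_M^{-1}\hat\chi S_c\begin{pmatrix}0\\g\end{pmatrix}.$$ Let $T>0$ and let $u^w\in C^1([0,T])$ with $u^w(0)=0$. A *strong solution* of a problem below is a function in $H^1(0,T;L^2(\mathbb R^+))\cap L^2(0,T;H^2(\mathbb R^+))$ (with its continuous representative on $[0,T]\times[0,\infty)$) which satisfies the equation almost everywhere and the initial and boundary conditions in the sense of traces. Viscous layer: $\bar u^{(0)},\bar u^{(1)},\bar u^{(2)}$ are strong solutions, in the variables $(t,y)\in(0,T)\times(0,\infty)$ and with zero initial data, of $$\partial_t\bar u^{(0)}-\partial_{yy}\bar u^{(0)}=0,\qquad \bar u^{(0)}(t,0)=u^w(t),$$ $$\partial_t\bar u^{(1)}-\partial_{yy}\bar u^{(1)}=0,\qquad \bar u^{(1)}(t,0)=K_M\,\partial_y\bar u^{(0)}(t,0),$$ $$\partial_t\bar u^{(2)}-\partial_{yy}\bar u^{(2)}=\partial_{ty}\bar\sigma^{(1)}+\sqrt2\,\partial_{yy}\bar w_2^{(2)},\qquad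 \bar u^{(2)}(t,0)=K_M\,\partial_y\bar u^{(1)}(t,0)+J_M\,\partial_tu^w(t),$$ where $\bar\sigma^{(1)}=-\partial_y\bar u^{(0)}$ and $\bar w_2^{(2)}=-\sqrt2\,\partial_y\bar\sigma^{(1)}=\sqrt2\,\partial_{yy}\bar u^{(0)}$; the right-hand side of the last equation is understood through $\partial_{yy}\bar u^{(0)}$ belonging to the same space $H^1(0,T;L^2)\cap L^2(0,T;H^2)$. For $\varepsilon>0$ put $u^a_{ns}(t,x)=\big(\bar u^{(0)}+\sqrt\varepsilon\,\bar u^{(1)}+\varepsilon\,\bar u^{(2)}\big)(t,x/\sqrt\varepsilon)$, and let $u_{ns}$ be a strong solution on $(0,T)\times(0,\infty)$, with zero initial data, of the simplified Navier–Stokes equation with the constructed boundary condition $$\partial_tu_{ns}-\varepsilon\,\partial_{xx}u_{ns}=0,\qquad u_{ns}(t,0)-\varepsilon K_M\,\partial_xu_{ns}(t,0)=u^w(t)+\varepsilon J_M\,\partial_tu^w(t).$$ **Theorem.** (i) There is a constant $C=C(T)>0$, independent of $\varepsilon$ (it may depend on $M,\chi,T,u^w$), such that for all such $\bar u^{(0)},\bar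 u^{(1)},\bar u^{(2)}$, all $0<\varepsilon\le 1$, all such $u_{ns}$ and all $t\in[0,T]$, $$\|(u_{ns}-u^a_{ns})(t,\cdot)\|_{L^2(\mathbb R^+)}+\Big(\int_0^T|u_{ns}(s,0)-u^a_{ns}(s,0)|^2\,ds\Big)^{1/2}\le C(T)\,\varepsilon^{5/4}.$$ (ii) In particular the constructed boundary condition satisfies the matching requirement: the left-hand side is $o(\varepsilon)$ as $\varepsilon\to0^+$, uniformly in $t\in[0,T]$. That is, for every $\eta>0$ there is $\varepsilon_0>0$ such that the left-hand side is at most $\eta\,\varepsilon$ for all $0<\varepsilon<\varepsilon_0$, all $t\in[0,T]$ and all such $\bar u^{(0)},\bar u^{(1)},\bar u^{(2)},u_{ns}$. -/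

import Mathlib

open MeasureTheory Set Matrix

noncomputable section

namespace Couette

/-! ### The moment boundary matrices

The odd moment order is `M = 2 * N + 1` with `1 ≤ N`.  The even moments
`w₀ = u, w₂, …, w_{M-1}` are indexed by `Unit ⊕ Fin N`: the index `inl ()` stands for `w₀` and
`inr i` for `w_{2i+2}`.  The odd moments `w₃, w₅, …, w_M` are indexed by `Fin N`, the index `i`
standing for `w_{2i+3}`. -/

/-- The degree `k` of the even moment `w_k` with the given index. -/
def evenDegree {N : ℕ} : Unit ⊕ Fin N → ℕ :=
  Sum.elim (fun _ => 0) (fun i => 2 * (i : ℕ) + 2)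

/-- The orthonormal Hermite polynomial of degree `k` for the standard Gaussian weight. -/
def hermiteOrtho (k : ℕ) (ξ : ℝ) : ℝ :=
  Polynomial.aeval ξ (Polynomial.hermite k) / √(k.factorial : ℝ)

/-- The matrix `S_c` of the Grad boundary condition, restricted to the even moments
`w₀, w₂, …, w_{M-1}`: half-space moments `(√(2π) / 2) ⟨|ξ| φ_k φ_l⟩`. -/
def gradS (N : ℕ) : Matrix (Unit ⊕ Fin N) (Unit ⊕ Fin N) ℝ :=
  Matrix.of fun a b => √(2 * Real.pi) / 2 *
    ∫ ξ, |ξ| * hermiteOrtho (evenDegree a) ξ * hermiteOrtho (evenDegree b) ξ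
      ∂(ProbabilityTheory.gaussianReal 0 1)

/-- `χ̂ = 2 χ / ((2 - χ) √(2π))`, for the accommodation coefficient `χ`. -/
def chiHat (χ : ℝ) : ℝ := 2 * χ / ((2 - χ) * √(2 * Real.pi))

/-- The vector `(√2, 0, …, 0)` of length `N = (M - 1) / 2`. -/
def gVec (N : ℕ) : Fin N → ℝ := fun i => if (i : ℕ) = 0 then √2 else 0

/-- The lower bidiagonal matrix with diagonal `√3, √5, …, √M` and subdiagonal
`√4, √6, …, √(M - 1)`. -/
def knudsenM (N : ℕ) : Matrix (Fin N) (Fin N) ℝ :=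
  Matrix.of fun i j =>
    if (j : ℕ) = i then √(2 * (i : ℕ) + 3 : ℝ)
    else if (j : ℕ) + 1 = i then √(2 * (i : ℕ) + 2 : ℝ) else 0

/-- The symmetric matrix `[[0, M̂], [M̂ᵀ, 0]]` of the Knudsen layer equations. -/
def knudsenA (N : ℕ) : Matrix (Fin N ⊕ Fin N) (Fin N ⊕ Fin N) ℝ :=
  fromBlocks 0 (knudsenM N) (knudsenM N)ᵀ 0

/-- An orthogonal diagonalization `Â R = R diag(Λ₊, -Λ₊)` with `R = [[Rₑ, Rₑ], [Rₒ, -Rₒ]]` and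
`Λ₊` a positive diagonal matrix.  The columns of `[Rₑ; Rₒ]` span the initial values of the bounded
solutions of `Â ∂_z w = -w` on the half-line. -/
structure KnudsenDiagonalization (N : ℕ) where
  Re : Matrix (Fin N) (Fin N) ℝ
  Ro : Matrix (Fin N) (Fin N) ℝ
  lam : Fin N → ℝ
  lam_pos : ∀ i, 0 < lam i
  orthogonal : fromBlocks Re Re Ro (-Ro) ∈ Matrix.orthogonalGroup (Fin N ⊕ Fin N) ℝ
  eigen : knudsenA N * fromBlocks Re Re Ro (-Ro) =
    fromBlocks Re Re Ro (-Ro) * fromBlocks (diagonal lam) 0 0 (-diagonal lam)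

theorem knudsenM_det_ne_zero (N : ℕ) : (knudsenM N).det ≠ 0 := by
  have h : (knudsenM N).BlockTriangular OrderDual.toDual := by
    intro i j hij
    have hij' : (i : ℕ) < j := hij
    simp only [knudsenM, of_apply]
    rw [if_neg (by omega), if_neg (by omega)]
  rw [det_of_isLowerTriangular (knudsenM N) h]
  refine Finset.prod_ne_zero_iff.2 fun i _ => ?_
  simp only [knudsenM, of_apply, if_true]
  positivity

/-- Such a diagonalization exists. -/
theorem KnudsenDiagonalization.nonempty (N : ℕ) : Nonempty (KnudsenDiagonalization N) := by
  set A := knudsenM N with hA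
  have hdet : IsUnit A := (isUnit_iff_isUnit_det _).2 (knudsenM_det_ne_zero N).isUnit
  have hP : (A * Aᵀ).PosDef := by
    have h := Matrix.PosDef.mul_conjTranspose_self A
      (Matrix.vecMul_injective_of_isUnit hdet)
    simpa [conjTranspose_eq_transpose_of_trivial] using h
  set U : Matrix (Fin N) (Fin N) ℝ := (hP.1.eigenvectorUnitary : Matrix (Fin N) (Fin N) ℝ) with hU
  set e := hP.1.eigenvalues with he
  have hepos : ∀ i, 0 < e i := hP.eigenvalues_pos
  have hUU : Uᵀ * U = 1 := by
    have h := (Matrix.mem_unitaryGroup_iff').1 hP.1.eigenvectorUnitary.2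
    simpa [star_eq_conjTranspose, conjTranspose_eq_transpose_of_trivial] using h
  have hPU : A * Aᵀ * U = U * diagonal e := by
    ext i j
    have h := congrFun (hP.1.eigenvectorUnitary_mulVec j) i
    have h2 : (A * Aᵀ * U) i j = ((A * Aᵀ) *ᵥ (fun k => U k j)) i := rfl
    rw [h2, mul_diagonal]
    have h3 : (fun k => U k j) = U *ᵥ Pi.single j 1 := by
      ext k; simp
    have h4 := congrFun (hP.1.mulVec_eigenvectorBasis j) i
    have h5 : (fun k => U k j) = (hP.1.eigenvectorBasis j).ofLp := by
      ext k; simp [hU, Matrix.IsHermitian.eigenvectorUnitary_apply]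
    rw [h5, h4]
    simp [hU, he, Matrix.IsHermitian.eigenvectorUnitary_apply, mul_comm]
  have hc : (√2 : ℝ)⁻¹ * (√2)⁻¹ = 1 / 2 := by
    rw [← mul_inv, Real.mul_self_sqrt (by norm_num)]; norm_num
  have hsq : ∀ i, √(e i) * √(e i) = e i := fun i => Real.mul_self_sqrt (hepos i).le
  have hs0 : ∀ i, √(e i) ≠ 0 := fun i => (Real.sqrt_pos.2 (hepos i)).ne'
  set L : Matrix (Fin N) (Fin N) ℝ := diagonal (fun i => √(e i)) with hL
  set L' : Matrix (Fin N) (Fin N) ℝ := diagonal (fun i => (√(e i))⁻¹) with hL'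
  have hLL : diagonal e = L * L := by
    rw [hL, diagonal_mul_diagonal]; simp only [hsq]
  have hLL' : L * L' = 1 := by
    rw [hL, hL', diagonal_mul_diagonal]; simp [hs0]
  have hL'L : L' * L = 1 := by
    rw [hL, hL', diagonal_mul_diagonal]; simp [hs0]
  have hL't : L'ᵀ = L' := diagonal_transpose _
  have h1 : (A * (Aᵀ * U * L')) = U * L := by
    rw [← Matrix.mul_assoc, ← Matrix.mul_assoc, hPU, hLL, Matrix.mul_assoc, Matrix.mul_assoc,
      hLL', Matrix.mul_one]
  have h2 : Aᵀ * U = (Aᵀ * U * L') * L := by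
    rw [Matrix.mul_assoc, hL'L, Matrix.mul_one]
  have h3 : (Aᵀ * U * L')ᵀ * (Aᵀ * U * L') = 1 := by
    have : (Aᵀ * U * L')ᵀ * (Aᵀ * U * L') = L' * (Uᵀ * (A * (Aᵀ * U * L'))) := by
      simp [transpose_mul, hL't, Matrix.mul_assoc]
    rw [this, h1, ← Matrix.mul_assoc Uᵀ, hUU, Matrix.one_mul, hL'L]
  refine ⟨⟨(√2)⁻¹ • U, (√2)⁻¹ • (Aᵀ * U * L'), fun i => √(e i),
    fun i => Real.sqrt_pos.2 (hepos i), ?_, ?_⟩⟩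
  · rw [Matrix.mem_orthogonalGroup_iff']
    have half : (1 / 2 : ℝ) • (1 : Matrix (Fin N) (Fin N) ℝ) + (1 / 2 : ℝ) • 1 = 1 := by
      rw [← add_smul]; norm_num
    rw [fromBlocks_transpose, fromBlocks_multiply]
    simp only [transpose_smul, transpose_neg, smul_mul, Matrix.mul_smul, smul_smul, hUU,
      Matrix.mul_neg, Matrix.neg_mul, h3, hc, neg_neg, smul_neg, half, add_neg_cancel]
    exact fromBlocks_one
  · rw [knudsenA, fromBlocks_multiply, fromBlocks_multiply]
    simp only [← hA, ← hL, Matrix.zero_mul, Matrix.mul_zero, zero_add, add_zero, smul_mul,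
      Matrix.mul_smul, Matrix.mul_neg, Matrix.neg_mul, neg_neg, h1, ← h2,
      smul_zero, neg_zero, zero_add, add_zero]

/-- The matrix `H_M(χ)` of the linear system for the boundary values of the viscous and the
Knudsen layers. -/
def matH {N : ℕ} (D : KnudsenDiagonalization N) (χ : ℝ) :
    Matrix (Unit ⊕ Fin N) (Unit ⊕ Fin N) ℝ :=
  (chiHat χ • gradS N) * fromBlocks 1 (-(replicateRow Unit (gVec N) * D.Re)) 0 D.Re
    + fromBlocks 0 0 0 (knudsenM N * D.Ro)

/-- The coefficient `K_M(χ) = (1, 0) H_M(χ)⁻¹ (1, g)ᵀ`. -/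
def slipK {N : ℕ} (D : KnudsenDiagonalization N) (χ : ℝ) : ℝ :=
  ((matH D χ)⁻¹ *ᵥ Sum.elim (fun _ => 1) (gVec N)) (Sum.inl ())

/-- The coefficient `J_M(χ) = -(1, 0) H_M(χ)⁻¹ χ̂ S_c (0, g)ᵀ`. -/
def slipJ {N : ℕ} (D : KnudsenDiagonalization N) (χ : ℝ) : ℝ :=
  -((matH D χ)⁻¹ *ᵥ ((chiHat χ • gradS N) *ᵥ Sum.elim (fun _ => 0) (gVec N))) (Sum.inl ())

/-! ### Strong solutions on `[0, T] × [0, ∞)` -/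

/-- Lebesgue measure on `(0, T) × (0, ∞)`; the first coordinate is time. -/
def domainMeasure (T : ℝ) : Measure (ℝ × ℝ) :=
  (volume.restrict (Ioo 0 T)).prod (volume.restrict (Ioi 0))

/-- An element of `H¹(0, T; L²(ℝ⁺)) ∩ L²(0, T; H²(ℝ⁺))`, given by its continuous representative
`val` on `[0, T] × [0, ∞)`, together with its weak derivatives `∂_t`, `∂_x`, `∂_xx`.  Weak
derivatives are expressed by absolute continuity along almost every line parallel to an axis; for
almost every `t` the representative of `∂_x` is the one that is absolutely continuous on `[0, ∞)`,
so that `dx t 0` is the boundary trace of `∂_x`.  Square integrability contains the vanishing at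
`x = ∞`. -/
structure ParabolicFunction (T : ℝ) where
  val : ℝ → ℝ → ℝ
  dt : ℝ → ℝ → ℝ
  dx : ℝ → ℝ → ℝ
  dxx : ℝ → ℝ → ℝ
  continuousOn_val : ContinuousOn (fun p : ℝ × ℝ => val p.1 p.2) (Icc 0 T ×ˢ Ici 0)
  memLp_val : MemLp (fun p : ℝ × ℝ => val p.1 p.2) 2 (domainMeasure T)
  memLp_dt : MemLp (fun p : ℝ × ℝ => dt p.1 p.2) 2 (domainMeasure T)
  memLp_dx : MemLp (fun p : ℝ × ℝ => dx p.1 p.2) 2 (domainMeasure T)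
  memLp_dxx : MemLp (fun p : ℝ × ℝ => dxx p.1 p.2) 2 (domainMeasure T)
  val_eq_integral_dt : ∀ᵐ x ∂(volume.restrict (Ioi (0 : ℝ))), ∀ t ∈ Icc 0 T,
    val t x = val 0 x + ∫ s in (0 : ℝ)..t, dt s x
  val_eq_integral_dx : ∀ᵐ t ∂(volume.restrict (Ioo 0 T)), ∀ x ∈ Ici (0 : ℝ),
    val t x = val t 0 + ∫ z in (0 : ℝ)..x, dx t z
  dx_eq_integral_dxx : ∀ᵐ t ∂(volume.restrict (Ioo 0 T)), ∀ x ∈ Ici (0 : ℝ),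
    dx t x = dx t 0 + ∫ z in (0 : ℝ)..x, dxx t z

/-- The viscous layer coefficients `ū⁽⁰⁾, ū⁽¹⁾, ū⁽²⁾`, functions of `(t, y)` with zero initial
data, for the plate velocity `uw` and the coefficients `K`, `J` of the boundary conditions. -/
structure IsViscousLayer (T : ℝ) (uw : ℝ → ℝ) (K J : ℝ) (u0 u1 u2 : ParabolicFunction T) :
    Prop where
  initial0 : ∀ y ∈ Ici (0 : ℝ), u0.val 0 y = 0
  initial1 : ∀ y ∈ Ici (0 : ℝ), u1.val 0 y = 0
  initial2 : ∀ y ∈ Ici (0 : ℝ), u2.val 0 y = 0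
  eq0 : ∀ᵐ p ∂(domainMeasure T), u0.dt p.1 p.2 - u0.dxx p.1 p.2 = 0
  eq1 : ∀ᵐ p ∂(domainMeasure T), u1.dt p.1 p.2 - u1.dxx p.1 p.2 = 0
  /-- `∂_t ū⁽²⁾ - ∂_yy ū⁽²⁾ = ∂_ty σ̄⁽¹⁾ + √2 ∂_yy w̄₂⁽²⁾`, where `σ̄⁽¹⁾ = -∂_y ū⁽⁰⁾` and
  `w̄₂⁽²⁾ = -√2 ∂_y σ̄⁽¹⁾ = √2 ∂_yy ū⁽⁰⁾`; the function `v` is `∂_yy ū⁽⁰⁾`. -/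
  eq2 : ∃ v : ParabolicFunction T,
    (∀ᵐ p ∂(domainMeasure T), v.val p.1 p.2 = u0.dxx p.1 p.2) ∧
    ∀ᵐ p ∂(domainMeasure T),
      u2.dt p.1 p.2 - u2.dxx p.1 p.2 = -v.dt p.1 p.2 + √2 * (√2 * v.dxx p.1 p.2)
  boundary0 : ∀ t ∈ Icc 0 T, u0.val t 0 = uw t
  boundary1 : ∀ᵐ t ∂(volume.restrict (Ioo 0 T)), u1.val t 0 = K * u0.dx t 0
  boundary2 : ∀ᵐ t ∂(volume.restrict (Ioo 0 T)),
    u2.val t 0 = K * u1.dx t 0 + J * deriv uw t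

/-- The solution `u` of `∂_t u - ε ∂_xx u = 0` with zero initial data and the boundary condition
`u - ε K ∂_x u = uw + ε J ∂_t uw` at `x = 0`. -/
structure IsNSSolution (T : ℝ) (uw : ℝ → ℝ) (K J ε : ℝ) (u : ParabolicFunction T) : Prop where
  initial : ∀ x ∈ Ici (0 : ℝ), u.val 0 x = 0
  eq : ∀ᵐ p ∂(domainMeasure T), u.dt p.1 p.2 - ε * u.dxx p.1 p.2 = 0
  boundary : ∀ᵐ t ∂(volume.restrict (Ioo 0 T)),
    u.val t 0 - ε * K * u.dx t 0 = uw t + ε * J * deriv uw t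

/-- `u^a_ns(t, x) = (ū⁽⁰⁾ + √ε ū⁽¹⁾ + ε ū⁽²⁾)(t, x / √ε)`. -/
def approx {T : ℝ} (ε : ℝ) (u0 u1 u2 : ParabolicFunction T) (t x : ℝ) : ℝ :=
  u0.val t (x / √ε) + √ε * u1.val t (x / √ε) + ε * u2.val t (x / √ε)

/-- `‖(u - u^a_ns)(t, ·)‖_{L²(ℝ⁺)} + (∫₀ᵀ |u(s, 0) - u^a_ns(s, 0)|² ds)^{1/2}`, as an extended
nonnegative real number. -/
def errorAt {T : ℝ} (ε : ℝ) (u u0 u1 u2 : ParabolicFunction T) (t : ℝ) : ENNReal :=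
  eLpNorm (fun x => u.val t x - approx ε u0 u1 u2 t x) 2 (volume.restrict (Ioi 0)) +
    eLpNorm (fun s => u.val s 0 - approx ε u0 u1 u2 s 0) 2 (volume.restrict (Ioo 0 T))

end Couette

end

open Filter Topology

namespace Couette

/-! With `δ = √ε` and `x = δ y`, consider the remainder `w(t, y) = u_ns(t, δ y) - ū⁽⁰⁾ - δ ū⁽¹⁾ - δ²
ū⁽²⁾`. The layer equations cancel the lower orders: `w` has zero initial data, solves `∂_t w - ∂_yy
w = -δ² f` with a fixed source `f ∈ L²`, and satisfies `w = δ K (∂_y w + δ² ∂_y ū⁽²⁾)` at `y = 0`.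

Testing with `w` produces the boundary flux `-w ∂_y w`. If `K > 0`, the boundary relation turns it
into `-w² / (δ K) + δ² w ∂_y ū⁽²⁾`, at most `-w² / (2 δ K) + (δ⁵ K / 2) (∂_y ū⁽²⁾)²`; if `K = 0`, it
vanishes. Hence `‖w(t)‖² = O(δ⁴)` and the squared trace norm is `O(δ⁵)`. Returning to `x` multiplies
the squared slice norm by `δ`, so both norms are `O(δ^{5/2}) = O(ε^{5/4})`.

Three facts carry this: the energy estimate `energy_bound`; the sign `0 ≤ K` (`slipK_nonneg`), from
positivity of the half-space moment matrix and of `Λ₊`; and uniqueness of the layer coefficients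
(`IsViscousLayer.unique`), which frees the constant from the choice of layer. -/

/-! ### Integration by parts and square integrable slices -/

/-- Integration by parts for primitives of integrable functions. -/
theorem integral_mul_primitive {f g F G : ℝ → ℝ} {a b : ℝ} (hab : a ≤ b)
    (hf : IntegrableOn f (Ioo a b)) (hg : IntegrableOn g (Ioo a b))
    (hF : ∀ x ∈ Icc a b, F x = F a + ∫ z in a..x, f z)
    (hG : ∀ x ∈ Icc a b, G x = G a + ∫ z in a..x, g z) :
    ∫ x in a..b, (f x * G x + F x * g x) = F b * G b - F a * G a := by
  have hf' : IntervalIntegrable f volume a b :=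
    (intervalIntegrable_iff_integrableOn_Ioo_of_le hab).2 hf
  have hg' : IntervalIntegrable g volume a b :=
    (intervalIntegrable_iff_integrableOn_Ioo_of_le hab).2 hg
  have hac : ∀ {h : ℝ → ℝ} (c : ℝ), IntervalIntegrable h volume a b →
      AbsolutelyContinuousOnInterval (fun x => c + ∫ z in a..x, h z) a b := fun c hh =>
    AbsolutelyContinuousOnInterval.add
      ((LipschitzWith.const c).lipschitzOnWith (s := uIcc a b)).absolutelyContinuousOnInterval
      (hh.absolutelyContinuousOnInterval_intervalIntegral left_mem_uIcc)
  -- `F` and `G` are controlled only on `[a, b]`, so the product rule is applied to the globally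
  -- defined primitives, whose derivatives are `f` and `g` almost everywhere.
  have key := (hac (F a) hf').integral_deriv_mul_eq_sub (hac (G a) hg')
  rw [← hF b ⟨hab, le_rfl⟩, ← hG b ⟨hab, le_rfl⟩] at key
  simp only [intervalIntegral.integral_same, add_zero] at key
  rw [← key]
  refine intervalIntegral.integral_congr_ae ?_
  filter_upwards [hf'.ae_hasDerivAt_integral, hg'.ae_hasDerivAt_integral] with x h1 h2 hx
  have hx' := uIoc_subset_uIcc hx
  have d1 := ((h1 hx' a left_mem_uIcc).const_add (F a)).deriv
  have d2 := ((h2 hx' a left_mem_uIcc).const_add (G a)).deriv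
  rw [uIcc_of_le hab] at hx'
  rw [d1, d2, ← hF x hx', ← hG x hx']

/-- Integration by parts on the half-line for primitives. -/
theorem integral_Ioi_mul_primitive {f g F G : ℝ → ℝ}
    (hf : MemLp f 2 (volume.restrict (Ioi 0))) (hg : MemLp g 2 (volume.restrict (Ioi 0)))
    (hF2 : MemLp F 2 (volume.restrict (Ioi 0))) (hG2 : MemLp G 2 (volume.restrict (Ioi 0)))
    (hF : ∀ x ∈ Ici (0 : ℝ), F x = F 0 + ∫ z in (0 : ℝ)..x, f z)
    (hG : ∀ x ∈ Ici (0 : ℝ), G x = G 0 + ∫ z in (0 : ℝ)..x, g z) :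
    ∫ x in Ioi (0 : ℝ), (f x * G x + F x * g x) = -(F 0 * G 0) := by
  have hi : IntegrableOn (fun x => f x * G x + F x * g x) (Ioi 0) :=
    (hf.integrable_mul hG2).add (hF2.integrable_mul hg)
  have h1 := intervalIntegral_tendsto_integral_Ioi (μ := volume) 0 hi tendsto_id
  have hloc : ∀ {h : ℝ → ℝ} (b : ℝ), MemLp h 2 (volume.restrict (Ioi 0)) →
      IntegrableOn h (Ioo 0 b) := fun b hh =>
    (hh.mono_measure (Measure.restrict_mono Ioo_subset_Ioi_self le_rfl)).integrable one_le_two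
  have h2 : Tendsto (fun x => F x * G x) atTop
      (𝓝 ((∫ x in Ioi (0 : ℝ), (f x * G x + F x * g x)) + F 0 * G 0)) := by
    refine (h1.add_const (F 0 * G 0)).congr' ?_
    filter_upwards [eventually_ge_atTop 0] with b hb
    rw [id, integral_mul_primitive hb (hloc b hf) (hloc b hg)
      (fun x hx => hF x hx.1) (fun x hx => hG x hx.1)]
    ring
  -- `F * G` has a limit at infinity and is integrable there, so the limit is zero: no boundary term
  -- appears at infinity.
  have h3 : IntegrableAtFilter (fun x => F x * G x) atTop volume :=
    ⟨Ioi 0, Ioi_mem_atTop 0, hF2.integrable_mul hG2⟩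
  have h4 := h3.eq_zero_of_tendsto (fun s hs => by
    obtain ⟨a, ha⟩ := mem_atTop_sets.1 hs
    exact eq_top_mono (measure_mono (fun x hx => ha x hx : Ici a ⊆ s)) Real.volume_Ici) h2
  linarith

theorem domainMeasure_eq (T : ℝ) :
    domainMeasure T = (volume : Measure (ℝ × ℝ)).restrict (Ioo 0 T ×ˢ Ioi 0) := by
  rw [domainMeasure, Measure.prod_restrict, Measure.volume_eq_prod]

theorem domainMeasure_mono {s T : ℝ} (h : s ≤ T) : domainMeasure s ≤ domainMeasure T := by
  rw [domainMeasure_eq, domainMeasure_eq]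
  exact Measure.restrict_mono (prod_mono (Ioo_subset_Ioo_right h) subset_rfl) le_rfl

theorem memLp_two_prod_right_ae {μ ν : Measure ℝ} [SFinite μ] [SFinite ν] {f : ℝ → ℝ → ℝ}
    (hf : MemLp (fun p : ℝ × ℝ => f p.1 p.2) 2 (μ.prod ν)) : ∀ᵐ x ∂μ, MemLp (f x) 2 ν := by
  filter_upwards [hf.aestronglyMeasurable.prodMk_left, hf.integrable_sq.prod_right_ae]
    with x h1 h2
  exact (memLp_two_iff_integrable_sq h1).2 h2

theorem memLp_two_prod_left_ae {μ ν : Measure ℝ} [SFinite μ] [SFinite ν] {f : ℝ → ℝ → ℝ}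
    (hf : MemLp (fun p : ℝ × ℝ => f p.1 p.2) 2 (μ.prod ν)) :
    ∀ᵐ y ∂ν, MemLp (fun x => f x y) 2 μ :=
  memLp_two_prod_right_ae (f := fun y x => f x y)
    (hf.comp_measurePreserving Measure.measurePreserving_swap)

/-! ### Energy estimates for the heat operator -/

namespace ParabolicFunction

variable {T : ℝ} (w : ParabolicFunction T)

theorem continuousOn_slice {t : ℝ} (ht : t ∈ Icc 0 T) : ContinuousOn (w.val t) (Ici 0) :=
  w.continuousOn_val.comp (f := fun x : ℝ => (t, x)) (by fun_prop) fun _ hx => ⟨ht, hx⟩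

theorem continuousOn_trace : ContinuousOn (fun t => w.val t 0) (Icc 0 T) :=
  w.continuousOn_val.comp (f := fun t : ℝ => (t, (0 : ℝ))) (by fun_prop)
    fun _ ht => ⟨ht, self_mem_Ici⟩

theorem integrable_trace_sq {t : ℝ} (ht : t ≤ T) :
    IntegrableOn (fun s => w.val s 0 ^ 2) (Ioo 0 t) :=
  (((w.continuousOn_trace.pow 2).integrableOn_Icc)).mono_set
    ((Ioo_subset_Ioo_right ht).trans Ioo_subset_Icc_self)

/-- Along almost every line `x = const`, `w²` is the time integral of `2 w ∂_t w`; Fubini then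
integrates in `x`. This gives square integrability at every time, whereas membership in `L²` of the
strip gives it only at almost every time. -/
theorem integrable_slice_sq (h0 : ∀ x ∈ Ici (0 : ℝ), w.val 0 x = 0) {t : ℝ}
    (ht : t ∈ Icc 0 T) :
    IntegrableOn (fun x => w.val t x ^ 2) (Ioi 0) ∧
      ∫ x in Ioi (0 : ℝ), w.val t x ^ 2 =
        2 * ∫ p, w.dt p.1 p.2 * w.val p.1 p.2 ∂(domainMeasure t) := by
  have hm := domainMeasure_mono ht.2
  have hint : Integrable (fun p : ℝ × ℝ => 2 * (w.dt p.1 p.2 * w.val p.1 p.2))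
      (domainMeasure t) :=
    ((w.memLp_dt.mono_measure hm).integrable_mul (w.memLp_val.mono_measure hm)).const_mul 2
  have hae : ∀ᵐ x ∂(volume.restrict (Ioi (0 : ℝ))),
      ∫ s in Ioo 0 t, 2 * (w.dt s x * w.val s x) = w.val t x ^ 2 := by
    filter_upwards [w.val_eq_integral_dt, memLp_two_prod_left_ae (w.memLp_dt.mono_measure hm),
      ae_restrict_mem measurableSet_Ioi] with x hx hdt hx0
    have h := integral_mul_primitive (F := fun s => w.val s x) (G := fun s => w.val s x) ht.1
      (hdt.integrable one_le_two) (hdt.integrable one_le_two)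
      (fun s hs => hx s ⟨hs.1, hs.2.trans ht.2⟩) (fun s hs => hx s ⟨hs.1, hs.2.trans ht.2⟩)
    simp only [h0 x (Ioi_subset_Ici_self hx0), mul_zero, sub_zero] at h
    rw [intervalIntegral.integral_of_le ht.1, integral_Ioc_eq_integral_Ioo] at h
    rw [sq, ← h]
    congr 1 with s
    ring
  constructor
  · exact (Integrable.integral_prod_right hint).congr hae
  · rw [← integral_const_mul, domainMeasure, integral_prod_symm _ hint]
    exact integral_congr_ae (hae.mono fun x hx => hx.symm)

theorem ae_memLp : ∀ᵐ s ∂(volume.restrict (Ioo 0 T)),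
    MemLp (w.val s) 2 (volume.restrict (Ioi 0)) ∧ MemLp (w.dx s) 2 (volume.restrict (Ioi 0)) ∧
      MemLp (w.dxx s) 2 (volume.restrict (Ioi 0)) := by
  filter_upwards [memLp_two_prod_right_ae w.memLp_val, memLp_two_prod_right_ae w.memLp_dx,
    memLp_two_prod_right_ae w.memLp_dxx] with s h1 h2 h3
  exact ⟨h1, h2, h3⟩

theorem ae_integral_dxx_mul_val : ∀ᵐ s ∂(volume.restrict (Ioo 0 T)),
    ∫ y in Ioi (0 : ℝ), (w.dxx s y * w.val s y + w.dx s y * w.dx s y) =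
      -(w.dx s 0 * w.val s 0) := by
  filter_upwards [w.ae_memLp, w.val_eq_integral_dx, w.dx_eq_integral_dxx] with s h h1 h2
  exact integral_Ioi_mul_primitive h.2.2 h.2.1 h.2.1 h.1 h2 h1

theorem ae_integral_dxx_mul_dx : ∀ᵐ s ∂(volume.restrict (Ioo 0 T)),
    ∫ y in Ioi (0 : ℝ), -(w.dxx s y * w.dx s y + w.dx s y * w.dxx s y) =
      w.dx s 0 ^ 2 := by
  filter_upwards [w.ae_memLp, w.dx_eq_integral_dxx] with s h h2
  rw [integral_neg, integral_Ioi_mul_primitive h.2.2 h.2.2 h.2.1 h.2.1 h2 h2, neg_neg, sq]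

/-- The squared flux is an integral over the half-line of a product of `L²` functions, so Fubini
yields its measurability and integrability together. -/
theorem integrable_dx_trace_sq : IntegrableOn (fun s => w.dx s 0 ^ 2) (Ioo 0 T) := by
  have hint : Integrable (fun p : ℝ × ℝ =>
      -(w.dxx p.1 p.2 * w.dx p.1 p.2 + w.dx p.1 p.2 * w.dxx p.1 p.2)) (domainMeasure T) :=
    ((w.memLp_dxx.integrable_mul w.memLp_dx).add (w.memLp_dx.integrable_mul w.memLp_dxx)).neg
  exact (Integrable.integral_prod_left hint).congr w.ae_integral_dxx_mul_dx

/-- The energy identity of the heat operator on the half-line. -/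
theorem energy_identity (h0 : ∀ x ∈ Ici (0 : ℝ), w.val 0 x = 0) {t : ℝ} (ht : t ∈ Icc 0 T) :
    IntegrableOn (fun s => w.dx s 0 * w.val s 0) (Ioo 0 t) ∧
      (∫ x in Ioi (0 : ℝ), w.val t x ^ 2) / 2 + ∫ p, w.dx p.1 p.2 ^ 2 ∂(domainMeasure t) =
        (∫ p, (w.dt p.1 p.2 - w.dxx p.1 p.2) * w.val p.1 p.2 ∂(domainMeasure t)) -
          ∫ s in Ioo 0 t, w.dx s 0 * w.val s 0 := by
  have hm := domainMeasure_mono ht.2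
  have hv := w.memLp_val.mono_measure hm
  have hdt := w.memLp_dt.mono_measure hm
  have hdx := w.memLp_dx.mono_measure hm
  have hdxx := w.memLp_dxx.mono_measure hm
  have i1 : Integrable (fun p : ℝ × ℝ => w.dt p.1 p.2 * w.val p.1 p.2) (domainMeasure t) :=
    hdt.integrable_mul hv
  have i2 : Integrable (fun p : ℝ × ℝ => w.dxx p.1 p.2 * w.val p.1 p.2) (domainMeasure t) :=
    hdxx.integrable_mul hv
  have i3 : Integrable (fun p : ℝ × ℝ => w.dx p.1 p.2 * w.dx p.1 p.2) (domainMeasure t) :=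
    hdx.integrable_mul hdx
  have hae := ae_restrict_of_ae_restrict_of_subset (Ioo_subset_Ioo_right ht.2 : Ioo 0 t ⊆ Ioo 0 T)
    w.ae_integral_dxx_mul_val
  have i4 : IntegrableOn (fun s => w.dx s 0 * w.val s 0) (Ioo 0 t) := by
    refine ((Integrable.integral_prod_left (i2.add i3)).congr hae).neg.congr ?_
    exact ae_of_all _ fun s => neg_neg _
  refine ⟨i4, ?_⟩
  have e1 := (w.integrable_slice_sq h0 ht).2
  have e2 : (∫ p, w.dxx p.1 p.2 * w.val p.1 p.2 ∂(domainMeasure t)) +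
      ∫ p, w.dx p.1 p.2 * w.dx p.1 p.2 ∂(domainMeasure t) =
      -∫ s in Ioo 0 t, w.dx s 0 * w.val s 0 := by
    rw [← integral_add i2 i3, ← integral_neg]
    exact (integral_prod _ (i2.add i3)).trans (integral_congr_ae hae)
  have e3 : ∫ p, (w.dt p.1 p.2 - w.dxx p.1 p.2) * w.val p.1 p.2 ∂(domainMeasure t) =
      (∫ p, w.dt p.1 p.2 * w.val p.1 p.2 ∂(domainMeasure t)) -
        ∫ p, w.dxx p.1 p.2 * w.val p.1 p.2 ∂(domainMeasure t) := by
    rw [← integral_sub i1 i2]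
    simp only [sub_mul]
  simp only [sq (w.dx _ _)]
  rw [e1, e3]
  linarith

/-- Stability of the heat equation under a square integrable source and a dissipative boundary
condition with an integrable defect `b`. -/
theorem energy_bound (w : ParabolicFunction T) (hT : 0 < T)
    (h0 : ∀ x ∈ Ici (0 : ℝ), w.val 0 x = 0) {r : ℝ × ℝ → ℝ} (hr : MemLp r 2 (domainMeasure T))
    (heq : ∀ᵐ p ∂(domainMeasure T), w.dt p.1 p.2 - w.dxx p.1 p.2 = r p) {a : ℝ} (ha : 0 ≤ a)
    {b : ℝ → ℝ} (hb : IntegrableOn b (Ioo 0 T)) (hb0 : ∀ s, 0 ≤ b s)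
    (hbd : ∀ᵐ s ∂(volume.restrict (Ioo 0 T)),
      -(w.dx s 0 * w.val s 0) ≤ -(a * w.val s 0 ^ 2) + b s) :
    (∀ t ∈ Icc 0 T, ∫ x in Ioi (0 : ℝ), w.val t x ^ 2 ≤
      4 * (T * (∫ p, r p ^ 2 ∂(domainMeasure T)) + ∫ s in Ioo 0 T, b s)) ∧
    a * ∫ s in Ioo 0 T, w.val s 0 ^ 2 ≤
      2 * (T * (∫ p, r p ^ 2 ∂(domainMeasure T)) + ∫ s in Ioo 0 T, b s) := by
  set F := ∫ p, r p ^ 2 ∂(domainMeasure T)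
  set B := ∫ s in Ioo 0 T, b s
  set Y := ∫ p, w.val p.1 p.2 ^ 2 ∂(domainMeasure T) with hY
  have iY := w.memLp_val.integrable_sq
  have iF := hr.integrable_sq
  have hmaj : Integrable (fun p : ℝ × ℝ => T * r p ^ 2 + 1 / (4 * T) * w.val p.1 p.2 ^ 2)
      (domainMeasure T) := (iF.const_mul _).add (iY.const_mul _)
  have key : ∀ t ∈ Icc 0 T, (∫ x in Ioi (0 : ℝ), w.val t x ^ 2) / 2 +
      a * ∫ s in Ioo 0 t, w.val s 0 ^ 2 ≤ T * F + 1 / (4 * T) * Y + B := by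
    intro t ht
    have hm := domainMeasure_mono ht.2
    have hsub : Ioo 0 t ⊆ Ioo 0 T := Ioo_subset_Ioo_right ht.2
    obtain ⟨i4, he⟩ := w.energy_identity h0 ht
    have e1 : ∫ p, (w.dt p.1 p.2 - w.dxx p.1 p.2) * w.val p.1 p.2 ∂(domainMeasure t) ≤
        T * F + 1 / (4 * T) * Y := by
      calc _ ≤ ∫ p, (T * r p ^ 2 + 1 / (4 * T) * w.val p.1 p.2 ^ 2) ∂(domainMeasure t) := by
            refine integral_mono_ae (((w.memLp_dt.sub w.memLp_dxx).mono_measure hm).integrable_mul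
              (w.memLp_val.mono_measure hm)) (hmaj.mono_measure hm) ?_
            filter_upwards [Measure.absolutelyContinuous_of_le hm heq] with p hp
            -- Young's inequality with weight `1 / (4 T)`, chosen so that time integration of the
            -- energy bound returns only half of `Y`.
            rw [hp, ← sub_nonneg]
            have : T * r p ^ 2 + 1 / (4 * T) * w.val p.1 p.2 ^ 2 - r p * w.val p.1 p.2 =
                (2 * T * r p - w.val p.1 p.2) ^ 2 / (4 * T) := by
              field_simp
              ring
            rw [this]
            positivity
        _ ≤ ∫ p, (T * r p ^ 2 + 1 / (4 * T) * w.val p.1 p.2 ^ 2) ∂(domainMeasure T) :=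
            integral_mono_measure hm (ae_of_all _ fun p => by positivity) hmaj
        _ = _ := by
            rw [integral_add (iF.const_mul _) (iY.const_mul _), integral_const_mul,
              integral_const_mul]
    have e2 : -∫ s in Ioo 0 t, w.dx s 0 * w.val s 0 ≤
        -(a * ∫ s in Ioo 0 t, w.val s 0 ^ 2) + B := by
      have ib := hb.mono_set hsub
      have iβ := ((w.integrable_trace_sq ht.2).const_mul a).neg
      calc _ = ∫ s in Ioo 0 t, -(w.dx s 0 * w.val s 0) := (integral_neg _).symm
        _ ≤ ∫ s in Ioo 0 t, (-(a * w.val s 0 ^ 2) + b s) :=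
            integral_mono_ae i4.neg (iβ.add ib)
              (ae_restrict_of_ae_restrict_of_subset hsub hbd)
        _ = -(a * ∫ s in Ioo 0 t, w.val s 0 ^ 2) + ∫ s in Ioo 0 t, b s := by
            rw [← integral_const_mul, ← integral_neg]
            exact integral_add iβ ib
        _ ≤ _ := by
            gcongr
            exact setIntegral_mono_set hb (ae_of_all _ hb0) hsub.eventuallyLE
    have e3 : 0 ≤ ∫ p, w.dx p.1 p.2 ^ 2 ∂(domainMeasure t) :=
      integral_nonneg fun p => sq_nonneg _
    linarith
  have hβ : ∀ t, 0 ≤ a * ∫ s in Ioo 0 t, w.val s 0 ^ 2 := fun t =>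
    mul_nonneg ha (integral_nonneg fun s => sq_nonneg _)
  -- Integrating `key` over `(0, T)` gives `Y ≤ 2 T (T F + B) + Y / 2`; absorbing the last term
  -- takes the place of Gronwall's inequality.
  have hYle : Y ≤ T * (2 * (T * F + 1 / (4 * T) * Y + B)) := by
    have h1 : Y = ∫ s in Ioo 0 T, ∫ x in Ioi (0 : ℝ), w.val s x ^ 2 := integral_prod _ iY
    have h2 : ∫ s in Ioo 0 T, (2 * (T * F + 1 / (4 * T) * Y + B)) =
        T * (2 * (T * F + 1 / (4 * T) * Y + B)) := by
      simp [hT.le]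
    rw [← h2]
    conv_lhs => rw [h1]
    refine setIntegral_mono_on (Integrable.integral_prod_left iY)
      (integrableOn_const (by simp))
      measurableSet_Ioo fun s hs => ?_
    have := key s (Ioo_subset_Icc_self hs)
    have := hβ s
    linarith
  have hYle' : 1 / (4 * T) * Y ≤ T * F + B := by
    have h3 : T * (2 * (T * F + 1 / (4 * T) * Y + B)) = 2 * T * (T * F + B) + Y / 2 := by
      field_simp
      ring
    rw [one_div, inv_mul_le_iff₀ (by positivity)]
    linarith
  refine ⟨fun t ht => ?_, ?_⟩
  · have := key t ht
    have := hβ t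
    linarith
  · have h4 := key T ⟨hT.le, le_rfl⟩
    have : 0 ≤ ∫ x in Ioi (0 : ℝ), w.val T x ^ 2 := integral_nonneg fun s => sq_nonneg _
    linarith

/-- A continuous function on the closed strip vanishes if almost all of its slices do. -/
theorem slice_eq_zero (w : ParabolicFunction T) {t : ℝ} (ht : t ∈ Icc 0 T)
    (h : w.val t =ᵐ[volume.restrict (Ioi 0)] 0) : ∀ x ∈ Ici (0 : ℝ), w.val t x = 0 := by
  have h1 : EqOn (w.val t) 0 (Ioi 0) :=
    Measure.eqOn_open_of_ae_eq h isOpen_Ioi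
      ((w.continuousOn_slice ht).mono Ioi_subset_Ici_self) continuousOn_const
  exact h1.of_subset_closure (w.continuousOn_slice ht) continuousOn_const Ioi_subset_Ici_self
    (closure_Ioi (0 : ℝ)).superset

/-- Uniqueness for the heat equation with zero initial and Dirichlet boundary data. -/
theorem val_eq_zero (w : ParabolicFunction T) (hT : 0 < T)
    (h0 : ∀ x ∈ Ici (0 : ℝ), w.val 0 x = 0)
    (heq : ∀ᵐ p ∂(domainMeasure T), w.dt p.1 p.2 - w.dxx p.1 p.2 = 0)
    (hbd : ∀ᵐ s ∂(volume.restrict (Ioo 0 T)), w.val s 0 = 0) :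
    ∀ t ∈ Icc 0 T, ∀ x ∈ Ici (0 : ℝ), w.val t x = 0 := by
  intro t ht
  have h := (w.energy_bound hT h0 (r := 0) MemLp.zero' heq le_rfl (b := 0)
    integrableOn_zero (fun _ => le_rfl) (hbd.mono fun s hs => by simp [hs])).1 t ht
  have h1 : ∫ x in Ioi (0 : ℝ), w.val t x ^ 2 = 0 :=
    le_antisymm (by simpa using h) (integral_nonneg fun x => sq_nonneg _)
  refine w.slice_eq_zero ht ?_
  rw [integral_eq_zero_iff_of_nonneg (fun x => sq_nonneg _) (w.integrable_slice_sq h0 ht).1] at h1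
  filter_upwards [h1] with x hx
  simpa using hx

end ParabolicFunction

/-! ### Uniqueness of weak derivatives and linear combinations -/

/-- If an absolutely continuous function vanishes almost everywhere, so does its derivative. -/
theorem primitive_ae_zero {F g : ℝ → ℝ} {b : ℝ} (hb : 0 ≤ b) (hg : IntegrableOn g (Ioo 0 b))
    (hF : ∀ x ∈ Icc 0 b, F x = F 0 + ∫ z in (0 : ℝ)..x, g z)
    (h0 : F =ᵐ[volume.restrict (Ioo 0 b)] 0) : g =ᵐ[volume.restrict (Ioo 0 b)] 0 := by
  have hg' : IntervalIntegrable g volume 0 b :=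
    (intervalIntegrable_iff_integrableOn_Ioo_of_le hb).2 hg
  have hc : ContinuousOn (fun x => F 0 + ∫ z in (0 : ℝ)..x, g z) (Icc 0 b) := by
    rw [← uIcc_of_le hb]
    exact (LipschitzWith.const (F 0)).continuous.continuousOn.add
      (hg'.absolutelyContinuousOnInterval_intervalIntegral left_mem_uIcc).continuousOn
  have h1 : EqOn F 0 (Ioo 0 b) :=
    Measure.eqOn_open_of_ae_eq h0 isOpen_Ioo ((hc.congr hF).mono Ioo_subset_Icc_self)
      continuousOn_const
  rw [EventuallyEq, ae_restrict_iff' measurableSet_Ioo]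
  filter_upwards [hg'.ae_hasDerivAt_integral] with x hx hxb
  rw [uIcc_of_le hb] at hx
  have hx' := (hx (Ioo_subset_Icc_self hxb) 0 ⟨le_rfl, hb⟩).const_add (F 0)
  refine hx'.unique ((hasDerivAt_const x (0 : ℝ)).congr_of_eventuallyEq ?_)
  filter_upwards [Ioo_mem_nhds hxb.1 hxb.2] with y hy
  rw [← hF y (Ioo_subset_Icc_self hy), h1 hy, Pi.zero_apply]

theorem primitive_Ioi_ae_zero {F g : ℝ → ℝ} (hg : MemLp g 2 (volume.restrict (Ioi 0)))
    (hF : ∀ x ∈ Ici (0 : ℝ), F x = F 0 + ∫ z in (0 : ℝ)..x, g z)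
    (h0 : F =ᵐ[volume.restrict (Ioi 0)] 0) : g =ᵐ[volume.restrict (Ioi 0)] 0 := by
  have h : ∀ n : ℕ, g =ᵐ[volume.restrict (Ioo 0 (n : ℝ))] 0 := fun n =>
    primitive_ae_zero n.cast_nonneg
      ((hg.mono_measure (Measure.restrict_mono Ioo_subset_Ioi_self le_rfl)).integrable one_le_two)
      (fun x hx => hF x hx.1) (ae_restrict_of_ae_restrict_of_subset Ioo_subset_Ioi_self h0)
  rw [EventuallyEq, ae_restrict_iff' measurableSet_Ioi]
  filter_upwards [ae_all_iff.2 fun n => (ae_restrict_iff' measurableSet_Ioo).1 (h n)] with x hx hx0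
  obtain ⟨n, hn⟩ := exists_nat_gt x
  exact hx n ⟨hx0, hn⟩

theorem ae_zero_of_slices {μ ν : Measure ℝ} [SFinite μ] [SFinite ν] {f : ℝ → ℝ → ℝ}
    (hf : MemLp (fun p : ℝ × ℝ => f p.1 p.2) 2 (μ.prod ν)) (h : ∀ᵐ x ∂μ, f x =ᵐ[ν] 0) :
    ∀ᵐ p ∂(μ.prod ν), f p.1 p.2 = 0 := by
  have h1 : ∫ p : ℝ × ℝ, f p.1 p.2 ^ 2 ∂(μ.prod ν) = 0 := by
    rw [integral_prod _ hf.integrable_sq]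
    refine integral_eq_zero_of_ae (h.mono fun x hx => integral_eq_zero_of_ae ?_)
    filter_upwards [hx] with y hy
    simp [hy]
  rw [integral_eq_zero_iff_of_nonneg (fun p => sq_nonneg _) hf.integrable_sq] at h1
  filter_upwards [h1] with p hp
  simpa using hp

namespace ParabolicFunction

variable {T : ℝ}

theorem eqOn_zero_of_ae (w : ParabolicFunction T) (hT : 0 < T)
    (h : ∀ᵐ p ∂(domainMeasure T), w.val p.1 p.2 = 0) :
    ∀ t ∈ Icc 0 T, ∀ x ∈ Ici (0 : ℝ), w.val t x = 0 := by
  rw [domainMeasure_eq] at h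
  have hsub : Ioo 0 T ×ˢ Ioi (0 : ℝ) ⊆ Icc 0 T ×ˢ Ici 0 :=
    prod_mono Ioo_subset_Icc_self Ioi_subset_Ici_self
  have h1 : EqOn (fun p : ℝ × ℝ => w.val p.1 p.2) 0 (Ioo 0 T ×ˢ Ioi 0) :=
    Measure.eqOn_open_of_ae_eq h (isOpen_Ioo.prod isOpen_Ioi) (w.continuousOn_val.mono hsub)
      continuousOn_const
  have h2 := h1.of_subset_closure w.continuousOn_val continuousOn_const hsub
    (by rw [closure_prod_eq, closure_Ioo hT.ne, closure_Ioi])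
  exact fun t ht x hx => h2 (show (t, x) ∈ Icc 0 T ×ˢ Ici 0 from ⟨ht, hx⟩)

/-- The weak derivatives of the zero function vanish. -/
theorem derivatives_ae_zero (w : ParabolicFunction T) (hT : 0 < T)
    (h : ∀ t ∈ Icc 0 T, ∀ x ∈ Ici (0 : ℝ), w.val t x = 0) :
    (∀ᵐ p ∂(domainMeasure T), w.dt p.1 p.2 = 0) ∧
      (∀ᵐ p ∂(domainMeasure T), w.dxx p.1 p.2 = 0) ∧
        ∀ᵐ t ∂(volume.restrict (Ioo 0 T)), w.dx t 0 = 0 := by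
  have hdx : ∀ᵐ t ∂(volume.restrict (Ioo 0 T)), w.dx t =ᵐ[volume.restrict (Ioi 0)] 0 := by
    filter_upwards [w.ae_memLp, w.val_eq_integral_dx, ae_restrict_mem measurableSet_Ioo]
      with t ht h1 htT
    refine primitive_Ioi_ae_zero ht.2.1 h1 ?_
    filter_upwards [ae_restrict_mem measurableSet_Ioi] with x hx
    exact h t (Ioo_subset_Icc_self htT) x (Ioi_subset_Ici_self hx)
  refine ⟨?_, ?_, ?_⟩
  · have h1 : ∀ᵐ p ∂((volume.restrict (Ioi (0 : ℝ))).prod (volume.restrict (Ioo 0 T))),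
        w.dt p.2 p.1 = 0 := by
      refine ae_zero_of_slices (f := fun x t => w.dt t x)
        (w.memLp_dt.comp_measurePreserving Measure.measurePreserving_swap) ?_
      filter_upwards [w.val_eq_integral_dt, memLp_two_prod_left_ae w.memLp_dt,
        ae_restrict_mem measurableSet_Ioi] with x h1 h2 hx
      refine primitive_ae_zero (F := fun t => w.val t x) hT.le (h2.integrable one_le_two) h1 ?_
      filter_upwards [ae_restrict_mem measurableSet_Ioo] with t ht
      exact h t (Ioo_subset_Icc_self ht) x (Ioi_subset_Ici_self hx)
    exact Measure.measurePreserving_swap.quasiMeasurePreserving.ae h1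
  · refine ae_zero_of_slices w.memLp_dxx ?_
    filter_upwards [w.ae_memLp, w.dx_eq_integral_dxx, hdx] with t h1 h2 h3
    exact primitive_Ioi_ae_zero h1.2.2 h2 h3
  · filter_upwards [hdx, w.ae_integral_dxx_mul_dx] with t h1 h2
    -- Almost everywhere vanishing of `dx t` does not by itself fix its value at `0`; the trace
    -- identity `(∂_x w)²(0) = -2 ∫ ∂_xx w ∂_x w` does.
    have : w.dx t 0 ^ 2 = 0 := by
      rw [← h2]
      refine integral_eq_zero_of_ae ?_
      filter_upwards [h1] with x hx
      simp [hx]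
    simpa using this

/-- Linear combinations. -/
def addSmul (u : ParabolicFunction T) (c : ℝ) (v : ParabolicFunction T) : ParabolicFunction T where
  val t x := u.val t x + c * v.val t x
  dt t x := u.dt t x + c * v.dt t x
  dx t x := u.dx t x + c * v.dx t x
  dxx t x := u.dxx t x + c * v.dxx t x
  continuousOn_val := u.continuousOn_val.add (continuousOn_const.mul v.continuousOn_val)
  memLp_val := u.memLp_val.add (v.memLp_val.const_mul c)
  memLp_dt := u.memLp_dt.add (v.memLp_dt.const_mul c)
  memLp_dx := u.memLp_dx.add (v.memLp_dx.const_mul c)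
  memLp_dxx := u.memLp_dxx.add (v.memLp_dxx.const_mul c)
  val_eq_integral_dt := by
    filter_upwards [u.val_eq_integral_dt, v.val_eq_integral_dt, memLp_two_prod_left_ae u.memLp_dt,
      memLp_two_prod_left_ae v.memLp_dt] with x h1 h2 h3 h4 t ht
    have i : ∀ {f : ℝ → ℝ}, MemLp f 2 (volume.restrict (Ioo 0 T)) →
        IntervalIntegrable f volume 0 t := fun hf =>
      (intervalIntegrable_iff_integrableOn_Ioo_of_le ht.1).2
        ((hf.mono_measure (Measure.restrict_mono (Ioo_subset_Ioo_right ht.2) le_rfl)).integrable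
          one_le_two)
    rw [intervalIntegral.integral_add (i h3) ((i h4).const_mul c),
      intervalIntegral.integral_const_mul, h1 t ht, h2 t ht]
    ring
  val_eq_integral_dx := by
    filter_upwards [u.val_eq_integral_dx, v.val_eq_integral_dx, u.ae_memLp, v.ae_memLp]
      with t h1 h2 h3 h4 x hx
    have i : ∀ {f : ℝ → ℝ}, MemLp f 2 (volume.restrict (Ioi 0)) →
        IntervalIntegrable f volume 0 x := fun hf =>
      (intervalIntegrable_iff_integrableOn_Ioo_of_le hx).2
        ((hf.mono_measure (Measure.restrict_mono Ioo_subset_Ioi_self le_rfl)).integrable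
          one_le_two)
    rw [intervalIntegral.integral_add (i h3.2.1) ((i h4.2.1).const_mul c),
      intervalIntegral.integral_const_mul, h1 x hx, h2 x hx]
    ring
  dx_eq_integral_dxx := by
    filter_upwards [u.dx_eq_integral_dxx, v.dx_eq_integral_dxx, u.ae_memLp, v.ae_memLp]
      with t h1 h2 h3 h4 x hx
    have i : ∀ {f : ℝ → ℝ}, MemLp f 2 (volume.restrict (Ioi 0)) →
        IntervalIntegrable f volume 0 x := fun hf =>
      (intervalIntegrable_iff_integrableOn_Ioo_of_le hx).2
        ((hf.mono_measure (Measure.restrict_mono Ioo_subset_Ioi_self le_rfl)).integrable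
          one_le_two)
    rw [intervalIntegral.integral_add (i h3.2.2) ((i h4.2.2).const_mul c),
      intervalIntegral.integral_const_mul, h1 x hx, h2 x hx]
    ring

end ParabolicFunction

/-! ### Nonnegativity of the slip coefficient -/

theorem integrable_polynomial_gaussianReal (p : Polynomial ℝ) :
    Integrable (fun ξ => p.eval ξ) (ProbabilityTheory.gaussianReal 0 1) := by
  induction p using Polynomial.induction_on' with
  | add p q hp hq =>
    simp only [Polynomial.eval_add]
    exact hp.add hq
  | monomial n a =>
    have h := ((ProbabilityTheory.memLp_id_gaussianReal (μ := 0) (v := 1)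
      (n : NNReal)).integrable_norm_pow').norm
    simp only [Polynomial.eval_monomial]
    refine Integrable.const_mul ?_ a
    refine (integrable_norm_iff (by fun_prop)).1 (h.congr (ae_of_all _ fun ξ => ?_))
    simp

theorem hermiteOrtho_eq_eval (k : ℕ) (ξ : ℝ) :
    hermiteOrtho k ξ = (Polynomial.C (√(k.factorial : ℝ))⁻¹ *
      (Polynomial.hermite k).map (Int.castRingHom ℝ)).eval ξ := by
  simp [hermiteOrtho, div_eq_inv_mul, Polynomial.aeval_def, Polynomial.eval_map]

/-- Up to a positive factor, `gradS N` is the Gram matrix of the even Hermite polynomials for the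
nonnegative weight `|ξ| ω(ξ)`, so its quadratic form integrates a square. -/
theorem gradS_nonneg (N : ℕ) (a : Unit ⊕ Fin N → ℝ) : 0 ≤ a ⬝ᵥ (gradS N *ᵥ a) := by
  have hint : ∀ k l, Integrable (fun ξ => |ξ| * hermiteOrtho k ξ * hermiteOrtho l ξ)
      (ProbabilityTheory.gaussianReal 0 1) := by
    intro k l
    have h := (integrable_polynomial_gaussianReal (Polynomial.X *
      (Polynomial.C (√(k.factorial : ℝ))⁻¹ * (Polynomial.hermite k).map (Int.castRingHom ℝ)) *
      (Polynomial.C (√(l.factorial : ℝ))⁻¹ *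
        (Polynomial.hermite l).map (Int.castRingHom ℝ)))).norm
    have hm : Continuous fun ξ => |ξ| * hermiteOrtho k ξ * hermiteOrtho l ξ := by
      simp only [hermiteOrtho_eq_eval]
      fun_prop
    refine (integrable_norm_iff hm.aestronglyMeasurable).1 (h.congr (ae_of_all _ fun ξ => ?_))
    simp only [Polynomial.eval_mul, hermiteOrtho_eq_eval, Polynomial.eval_X, norm_mul,
      Real.norm_eq_abs, abs_abs]
  have hsum : a ⬝ᵥ (gradS N *ᵥ a) = √(2 * Real.pi) / 2 *
      ∫ ξ, |ξ| * (∑ i, a i * hermiteOrtho (evenDegree i) ξ) ^ 2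
        ∂(ProbabilityTheory.gaussianReal 0 1) := by
    have h1 : ∀ ξ, |ξ| * (∑ i, a i * hermiteOrtho (evenDegree i) ξ) ^ 2 =
        ∑ i, ∑ j, a i * a j *
          (|ξ| * hermiteOrtho (evenDegree i) ξ * hermiteOrtho (evenDegree j) ξ) := by
      intro ξ
      rw [sq, Finset.sum_mul_sum, Finset.mul_sum]
      refine Finset.sum_congr rfl fun i _ => ?_
      rw [Finset.mul_sum]
      exact Finset.sum_congr rfl fun j _ => by ring
    simp only [h1]
    rw [integral_finsetSum _ fun i _ => integrable_finsetSum _ fun j _ => (hint _ _).const_mul _]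
    simp only [integral_finsetSum _ fun j _ => (hint _ _).const_mul _, integral_const_mul,
      dotProduct, mulVec, Finset.mul_sum, gradS, of_apply]
    exact Finset.sum_congr rfl fun i _ => Finset.sum_congr rfl fun j _ => by ring
  rw [hsum]
  exact mul_nonneg (by positivity) (integral_nonneg fun ξ => by positivity)

theorem KnudsenDiagonalization.knudsenM_mul_Ro {N : ℕ} (D : KnudsenDiagonalization N) :
    knudsenM N * D.Ro = D.Re * diagonal D.lam := by
  have h := D.eigen
  rw [knudsenA, fromBlocks_multiply, fromBlocks_multiply] at h
  simpa using (fromBlocks_inj.1 h).1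

/-- Two blocks of the orthogonality relation say that `Reᵀ Re` and `Roᵀ Ro` are equal and sum to the
identity. -/
theorem KnudsenDiagonalization.transpose_Re_mul_Re {N : ℕ} (D : KnudsenDiagonalization N) :
    D.Reᵀ * D.Re = (1 / 2 : ℝ) • 1 := by
  have h := (Matrix.mem_orthogonalGroup_iff' _ _).1 D.orthogonal
  rw [fromBlocks_transpose, fromBlocks_multiply, ← fromBlocks_one] at h
  obtain ⟨h1, h2, -, -⟩ := fromBlocks_inj.1 h
  have h3 : (2 : ℝ) • (D.Reᵀ * D.Re) = 1 := by
    rw [← add_zero (1 : Matrix (Fin N) (Fin N) ℝ), ← h1, ← h2, two_smul]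
    simp only [Matrix.mul_neg]
    abel
  rw [← h3, smul_smul]
  norm_num

/-- The slip coefficient is nonnegative: the boundary condition is dissipative. -/
theorem slipK_nonneg {N : ℕ} (D : KnudsenDiagonalization N) {χ : ℝ} (hχ0 : 0 < χ) (hχ1 : χ ≤ 1) :
    0 ≤ slipK D χ := by
  by_cases hdet : IsUnit (matH D χ).det
  swap
  -- A singular `matH` has inverse `0` by convention, so the coefficient is `0`.
  · simp [slipK, nonsing_inv_apply_not_isUnit _ hdet]
  have hχ : 0 ≤ chiHat χ := by
    have : 0 < 2 - χ := by linarith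
    rw [chiHat]
    positivity
  set v : Unit ⊕ Fin N → ℝ := Sum.elim (fun _ => 1) (gVec N) with hv
  set z := (matH D χ)⁻¹ *ᵥ v with hz
  have hH : matH D χ *ᵥ z = v := by
    rw [hz, mulVec_mulVec, mul_nonsing_inv _ hdet, one_mulVec]
  set z1 : Fin N → ℝ := z ∘ Sum.inr with hz1
  set a := fromBlocks 1 (-(replicateRow Unit (gVec N) * D.Re)) 0 D.Re *ᵥ z with ha
  have ha' : a = Sum.elim (fun _ => z (Sum.inl ()) - gVec N ⬝ᵥ (D.Re *ᵥ z1)) (D.Re *ᵥ z1) := by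
    rw [ha, fromBlocks_mulVec]
    ext i
    rcases i with i | i
    · simp [← hz1, neg_mulVec, ← mulVec_mulVec, sub_eq_add_neg, mulVec, replicateRow]
    · simp [← hz1]
  have hH' : matH D χ *ᵥ z = chiHat χ • (gradS N *ᵥ a) +
      Sum.elim (fun _ => 0) (D.Re *ᵥ (diagonal D.lam *ᵥ z1)) := by
    rw [matH, add_mulVec, ← mulVec_mulVec, ← ha, smul_mulVec, D.knudsenM_mul_Ro,
      fromBlocks_mulVec, ← hz1]
    congr 1
    ext i
    rcases i with i | i <;> simp
  -- The `-gᵀ Re` block of `H_M` cancels the `g` in `v`. Hence `K = a ⬝ᵥ H z = χ̂ a ⬝ᵥ S_c a + ½ ∑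
  -- λᵢ zᵢ²`, a sum of nonnegative terms.
  have hval : a ⬝ᵥ v = z (Sum.inl ()) := by
    rw [ha', hv, sumElim_dotProduct_sumElim, dotProduct_comm (D.Re *ᵥ z1)]
    simp [dotProduct]
  have hdot : a ⬝ᵥ Sum.elim (fun _ => 0) (D.Re *ᵥ (diagonal D.lam *ᵥ z1)) =
      1 / 2 * ∑ i, D.lam i * z1 i ^ 2 := by
    have : (D.Re *ᵥ z1) ⬝ᵥ (D.Re *ᵥ (diagonal D.lam *ᵥ z1)) =
        z1 ⬝ᵥ ((D.Reᵀ * D.Re) *ᵥ (diagonal D.lam *ᵥ z1)) := by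
      rw [← mulVec_mulVec, dotProduct_mulVec z1, vecMul_transpose]
    rw [ha', sumElim_dotProduct_sumElim, this, D.transpose_Re_mul_Re]
    simp only [dotProduct, mul_zero, Finset.sum_const_zero, zero_add, smul_mulVec, one_mulVec,
      Pi.smul_apply, mulVec_diagonal, smul_eq_mul, Finset.mul_sum]
    exact Finset.sum_congr rfl fun i _ => by ring
  change 0 ≤ z (Sum.inl ())
  rw [← hval, ← hH, hH', dotProduct_add, dotProduct_smul, hdot, smul_eq_mul]
  have := gradS_nonneg N a
  have : 0 ≤ ∑ i, D.lam i * z1 i ^ 2 :=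
    Finset.sum_nonneg fun i _ => mul_nonneg (D.lam_pos i).le (sq_nonneg _)
  positivity

/-! ### Dilation of the space variable -/

theorem map_mul_left_restrict_Ioi {δ : ℝ} (hδ : 0 < δ) :
    (volume.restrict (Ioi (0 : ℝ))).map (δ * ·) =
      ENNReal.ofReal δ⁻¹ • volume.restrict (Ioi (0 : ℝ)) := by
  have h : (δ * ·) ⁻¹' Ioi (0 : ℝ) = Ioi 0 := by
    ext x
    simp [hδ]
  rw [← Measure.restrict_smul, ← abs_of_pos (inv_pos.2 hδ), ← Real.map_volume_mul_left hδ.ne',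
    Measure.restrict_map (by fun_prop) measurableSet_Ioi, h]

theorem map_scale_domainMeasure (T : ℝ) {δ : ℝ} (hδ : 0 < δ) :
    (domainMeasure T).map (Prod.map id (δ * ·)) = ENNReal.ofReal δ⁻¹ • domainMeasure T := by
  rw [domainMeasure, ← Measure.map_prod_map _ _ measurable_id (by fun_prop), Measure.map_id,
    map_mul_left_restrict_Ioi hδ, Measure.prod_smul_right]

theorem memLp_comp_scale {T δ : ℝ} (hδ : 0 < δ) {f : ℝ → ℝ → ℝ}
    (hf : MemLp (fun p : ℝ × ℝ => f p.1 p.2) 2 (domainMeasure T)) :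
    MemLp (fun p : ℝ × ℝ => f p.1 (δ * p.2)) 2 (domainMeasure T) := by
  refine MemLp.comp_of_map (f := Prod.map id (δ * ·))
    (g := fun p : ℝ × ℝ => f p.1 p.2) ?_ (by fun_prop)
  rw [map_scale_domainMeasure T hδ]
  exact hf.smul_measure ENNReal.ofReal_ne_top

theorem ae_domainMeasure_scale {T δ : ℝ} (hδ : 0 < δ) {P : ℝ → ℝ → Prop}
    (h : ∀ᵐ p ∂(domainMeasure T), P p.1 p.2) :
    ∀ᵐ p ∂(domainMeasure T), P p.1 (δ * p.2) := by
  refine ae_of_ae_map (f := Prod.map id (δ * ·)) (p := fun p : ℝ × ℝ => P p.1 p.2)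
    (by fun_prop) ?_
  rw [map_scale_domainMeasure T hδ]
  exact Measure.ae_smul_measure h _

namespace ParabolicFunction

/-- The function `(t, y) ↦ u (t, δ y)`. -/
def scale {T : ℝ} (u : ParabolicFunction T) (δ : ℝ) (hδ : 0 < δ) : ParabolicFunction T where
  val t y := u.val t (δ * y)
  dt t y := u.dt t (δ * y)
  dx t y := δ * u.dx t (δ * y)
  dxx t y := δ ^ 2 * u.dxx t (δ * y)
  continuousOn_val := u.continuousOn_val.comp (f := fun p : ℝ × ℝ => (p.1, δ * p.2))
    (by fun_prop) fun p hp => ⟨hp.1, mul_nonneg hδ.le hp.2⟩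
  memLp_val := memLp_comp_scale hδ u.memLp_val
  memLp_dt := memLp_comp_scale hδ u.memLp_dt
  memLp_dx := (memLp_comp_scale hδ u.memLp_dx).const_mul δ
  memLp_dxx := (memLp_comp_scale hδ u.memLp_dxx).const_mul (δ ^ 2)
  val_eq_integral_dt := by
    refine ae_of_ae_map (f := (δ * ·)) (p := fun x => ∀ t ∈ Icc 0 T,
      u.val t x = u.val 0 x + ∫ s in (0 : ℝ)..t, u.dt s x) (by fun_prop) ?_
    rw [map_mul_left_restrict_Ioi hδ]
    exact Measure.ae_smul_measure u.val_eq_integral_dt _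
  val_eq_integral_dx := by
    filter_upwards [u.val_eq_integral_dx] with t h x hx
    rw [h (δ * x) (mul_nonneg hδ.le hx), intervalIntegral.integral_const_mul,
      intervalIntegral.mul_integral_comp_mul_left, mul_zero]
  dx_eq_integral_dxx := by
    filter_upwards [u.dx_eq_integral_dxx] with t h x hx
    rw [h (δ * x) (mul_nonneg hδ.le hx), intervalIntegral.integral_const_mul, sq, mul_assoc,
      intervalIntegral.mul_integral_comp_mul_left, mul_zero, mul_add]

end ParabolicFunction

/-! ### Uniqueness of the layer and the remainder estimate -/

/-- The viscous layer coefficients are unique. -/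
theorem IsViscousLayer.unique {T : ℝ} (hT : 0 < T) {uw : ℝ → ℝ} {K J : ℝ}
    {u0 u1 u2 v0 v1 v2 : ParabolicFunction T} (hu : IsViscousLayer T uw K J u0 u1 u2)
    (hv : IsViscousLayer T uw K J v0 v1 v2) : ∀ t ∈ Icc 0 T, ∀ x ∈ Ici (0 : ℝ),
      u0.val t x = v0.val t x ∧ u1.val t x = v1.val t x ∧ u2.val t x = v2.val t x := by
  have h0 : ∀ t ∈ Icc 0 T, ∀ x ∈ Ici (0 : ℝ), (u0.addSmul (-1) v0).val t x = 0 := by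
    refine (u0.addSmul (-1) v0).val_eq_zero hT ?_ ?_ ?_
    · intro x hx
      simp [ParabolicFunction.addSmul, hu.initial0 x hx, hv.initial0 x hx]
    · filter_upwards [hu.eq0, hv.eq0] with p h1 h2
      simp only [ParabolicFunction.addSmul]
      linarith
    · filter_upwards [ae_restrict_mem measurableSet_Ioo] with t ht
      simp [ParabolicFunction.addSmul, hu.boundary0 t (Ioo_subset_Icc_self ht),
        hv.boundary0 t (Ioo_subset_Icc_self ht)]
  obtain ⟨-, hxx0, htr0⟩ := (u0.addSmul (-1) v0).derivatives_ae_zero hT h0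
  have h1 : ∀ t ∈ Icc 0 T, ∀ x ∈ Ici (0 : ℝ), (u1.addSmul (-1) v1).val t x = 0 := by
    refine (u1.addSmul (-1) v1).val_eq_zero hT ?_ ?_ ?_
    · intro x hx
      simp [ParabolicFunction.addSmul, hu.initial1 x hx, hv.initial1 x hx]
    · filter_upwards [hu.eq1, hv.eq1] with p h1 h2
      simp only [ParabolicFunction.addSmul]
      linarith
    · filter_upwards [hu.boundary1, hv.boundary1, htr0] with t h1 h2 h3
      simp only [ParabolicFunction.addSmul] at h3 ⊢
      rw [h1, h2]
      linear_combination K * h3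
  obtain ⟨-, -, htr1⟩ := (u1.addSmul (-1) v1).derivatives_ae_zero hT h1
  obtain ⟨f, hf, hfeq⟩ := hu.eq2
  obtain ⟨g, hg, hgeq⟩ := hv.eq2
  -- The representatives of `∂_yy ū⁽⁰⁾` chosen for the two layers may differ a priori; they agree by
  -- continuity, so their derivatives, which form the sources of `ū⁽²⁾`, agree almost everywhere.
  have hfg : ∀ t ∈ Icc 0 T, ∀ x ∈ Ici (0 : ℝ), (f.addSmul (-1) g).val t x = 0 := by
    refine (f.addSmul (-1) g).eqOn_zero_of_ae hT ?_
    filter_upwards [hf, hg, hxx0] with p h1 h2 h3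
    simp only [ParabolicFunction.addSmul] at h3 ⊢
    rw [h1, h2, h3]
  obtain ⟨htf, hxxf, -⟩ := (f.addSmul (-1) g).derivatives_ae_zero hT hfg
  have h2 : ∀ t ∈ Icc 0 T, ∀ x ∈ Ici (0 : ℝ), (u2.addSmul (-1) v2).val t x = 0 := by
    refine (u2.addSmul (-1) v2).val_eq_zero hT ?_ ?_ ?_
    · intro x hx
      simp [ParabolicFunction.addSmul, hu.initial2 x hx, hv.initial2 x hx]
    · filter_upwards [hfeq, hgeq, htf, hxxf] with p h1 h2 h3 h4
      simp only [ParabolicFunction.addSmul] at h3 h4 ⊢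
      linear_combination h1 - h2 - h3 + √2 * √2 * h4
    · filter_upwards [hu.boundary2, hv.boundary2, htr1] with t h1 h2 h3
      simp only [ParabolicFunction.addSmul] at h3 ⊢
      rw [h1, h2]
      linear_combination K * h3
  intro t ht x hx
  have e0 := h0 t ht x hx
  have e1 := h1 t ht x hx
  have e2 := h2 t ht x hx
  simp only [ParabolicFunction.addSmul] at e0 e1 e2
  exact ⟨by linarith, by linarith, by linarith⟩

theorem eLpNorm_two_le {α : Type*} [MeasurableSpace α] {μ : Measure α} {f : α → ℝ}
    (hf : MemLp f 2 μ) {A : ℝ} (hA : 0 ≤ A) (h : ∫ x, f x ^ 2 ∂μ ≤ A ^ 2) :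
    eLpNorm f 2 μ ≤ ENNReal.ofReal A := by
  rw [hf.eLpNorm_eq_integral_rpow_norm two_ne_zero ENNReal.ofNat_ne_top]
  refine ENNReal.ofReal_le_ofReal ?_
  simp only [ENNReal.toReal_ofNat, Real.rpow_ofNat, Real.norm_eq_abs, sq_abs]
  rw [← one_div, ← Real.sqrt_eq_rpow]
  exact Real.sqrt_le_iff.2 ⟨hA, h⟩

/-- The error bound with a constant depending on the given viscous layer. -/
theorem IsViscousLayer.exists_error_bound {T : ℝ} (hT : 0 < T) {uw : ℝ → ℝ} {K J : ℝ}
    (hK : 0 ≤ K) {u0 u1 u2 : ParabolicFunction T} (hu : IsViscousLayer T uw K J u0 u1 u2) :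
    ∃ C : ℝ, 0 < C ∧ ∀ ε : ℝ, 0 < ε → ε ≤ 1 → ∀ u : ParabolicFunction T,
      IsNSSolution T uw K J ε u → ∀ t ∈ Icc 0 T,
        errorAt ε u u0 u1 u2 t ≤ ENNReal.ofReal (C * ε ^ (5 / 4 : ℝ)) := by
  obtain ⟨v, -, hveq⟩ := hu.eq2
  set f : ℝ × ℝ → ℝ := fun p => -v.dt p.1 p.2 + √2 * (√2 * v.dxx p.1 p.2) with hf
  have hfm : MemLp f 2 (domainMeasure T) :=
    v.memLp_dt.neg.add ((v.memLp_dxx.const_mul √2).const_mul √2)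
  set F := ∫ p, f p ^ 2 ∂(domainMeasure T) with hF
  set Q := ∫ s in Ioo 0 T, u2.dx s 0 ^ 2 with hQ
  have hF0 : 0 ≤ F := integral_nonneg fun p => sq_nonneg _
  have hQ0 : 0 ≤ Q := integral_nonneg fun p => sq_nonneg _
  -- The damping rate `1 / (2 δ k)` needs `k ≠ 0`. When `K = 0` the remainder has zero trace and any
  -- positive `k` serves.
  obtain ⟨k, hk, hkK⟩ : ∃ k : ℝ, 0 < k ∧ (K = 0 ∨ K = k) := by
    rcases hK.eq_or_lt with h | h
    · exact ⟨1, one_pos, Or.inl h.symm⟩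
    · exact ⟨K, h, Or.inr rfl⟩
  set A := 4 * (T * F + K / 2 * Q) with hA
  have hA0 : 0 ≤ A := by positivity
  refine ⟨√A + √(k * A) + 1, by positivity, fun ε hε hε1 u hns t ht => ?_⟩
  obtain ⟨δ, hδ, rfl⟩ : ∃ δ : ℝ, 0 < δ ∧ δ ^ 2 = ε := ⟨√ε, Real.sqrt_pos.2 hε, Real.sq_sqrt hε.le⟩
  have hδ1 : δ ≤ 1 := (sq_le_one_iff₀ hδ.le).1 hε1
  have hsqrt : √(δ ^ 2) = δ := Real.sqrt_sq hδ.le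
  set w := (((u.scale δ hδ).addSmul (-1) u0).addSmul (-δ) u1).addSmul (-δ ^ 2) u2 with hw
  have hval : ∀ s x, u.val s x - approx (δ ^ 2) u0 u1 u2 s x = w.val s (δ⁻¹ * x) := by
    intro s x
    simp only [approx, hsqrt, hw, ParabolicFunction.addSmul, ParabolicFunction.scale,
      mul_inv_cancel_left₀ hδ.ne', div_eq_inv_mul]
    ring
  have hinit : ∀ x ∈ Ici (0 : ℝ), w.val 0 x = 0 := by
    intro x hx
    simp [hw, ParabolicFunction.addSmul, ParabolicFunction.scale, hu.initial0 x hx,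
      hu.initial1 x hx, hu.initial2 x hx, hns.initial (δ * x) (mul_nonneg hδ.le hx)]
  have heq : ∀ᵐ p ∂(domainMeasure T), w.dt p.1 p.2 - w.dxx p.1 p.2 = -δ ^ 2 * f p := by
    filter_upwards [ae_domainMeasure_scale hδ (P := fun t x => u.dt t x - δ ^ 2 * u.dxx t x = 0)
      hns.eq, hu.eq0, hu.eq1, hveq] with p h h0 h1 h2
    simp only [hw, ParabolicFunction.addSmul, ParabolicFunction.scale, hf, ← h2]
    linear_combination h - h0 - δ * h1
  have hbd : ∀ᵐ s ∂(volume.restrict (Ioo 0 T)), -(w.dx s 0 * w.val s 0) ≤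
      -(1 / (2 * δ * k) * w.val s 0 ^ 2) + δ ^ 5 * K / 2 * u2.dx s 0 ^ 2 := by
    filter_upwards [hns.boundary, hu.boundary1, hu.boundary2, ae_restrict_mem measurableSet_Ioo]
      with s h h1 h2 hs
    have h0 := hu.boundary0 s (Ioo_subset_Icc_self hs)
    -- The terms in `uw` and `J ∂_t uw` cancel; only the flux of `ū⁽²⁾`, not compensated by a
    -- further layer term, is left as a defect.
    have hb : w.val s 0 = δ * K * (w.dx s 0 + δ ^ 2 * u2.dx s 0) := by
      simp only [hw, ParabolicFunction.addSmul, ParabolicFunction.scale, mul_zero]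
      linear_combination h - h0 - δ * h1 - δ ^ 2 * h2
    rcases hkK with rfl | rfl
    · simp [hb]
    · rw [hb, ← sub_nonneg]
      -- Young's inequality in exact form: after substituting the boundary relation, the slack is a
      -- multiple of `(∂_y w)²`.
      have : -(1 / (2 * δ * K) * (δ * K * (w.dx s 0 + δ ^ 2 * u2.dx s 0)) ^ 2) +
          δ ^ 5 * K / 2 * u2.dx s 0 ^ 2 -
          -(w.dx s 0 * (δ * K * (w.dx s 0 + δ ^ 2 * u2.dx s 0))) =
          δ * K / 2 * w.dx s 0 ^ 2 := by
        field_simp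
        ring
      rw [this]
      positivity
  obtain ⟨hb1, hb2⟩ := w.energy_bound hT hinit (hfm.const_mul (-δ ^ 2)) heq
    (a := 1 / (2 * δ * k)) (by positivity)
    (u2.integrable_dx_trace_sq.const_mul (δ ^ 5 * K / 2)) (fun s => by positivity) hbd
  simp only [mul_pow, integral_const_mul, ← hF, ← hQ] at hb1 hb2
  have hrhs : T * ((-δ ^ 2) ^ 2 * F) + δ ^ 5 * K / 2 * Q ≤ δ ^ 4 * (A / 4) := by
    have h1 : δ ^ 5 * (K / 2 * Q) ≤ δ ^ 4 * (K / 2 * Q) :=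
      mul_le_mul_of_nonneg_right (pow_le_pow_of_le_one hδ.le hδ1 (by norm_num)) (by positivity)
    rw [hA]
    linarith
  set ρ := (δ ^ 2) ^ (5 / 4 : ℝ) with hρ
  have hρ0 : 0 ≤ ρ := by positivity
  have hρ2 : ρ ^ 2 = δ ^ 5 := by
    rw [hρ, ← Real.rpow_natCast, ← Real.rpow_natCast, ← Real.rpow_natCast, ← Real.rpow_mul hδ.le,
      ← Real.rpow_mul hδ.le]
    norm_num
  have hδi : 0 < δ⁻¹ := inv_pos.2 hδ
  have hslice := (w.integrable_slice_sq hinit ht).1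
  have hm1 : MemLp (fun x => w.val t (δ⁻¹ * x)) 2 (volume.restrict (Ioi 0)) := by
    have hc : ContinuousOn (fun x => w.val t (δ⁻¹ * x)) (Ioi 0) :=
      (w.continuousOn_slice ht).comp (by fun_prop) fun x hx => mul_nonneg hδi.le (le_of_lt hx)
    refine (memLp_two_iff_integrable_sq (hc.aestronglyMeasurable measurableSet_Ioi)).2 ?_
    refine (integrableOn_Ioi_comp_mul_left_iff (fun x => w.val t x ^ 2) 0 hδi).2 ?_
    rwa [mul_zero]
  have hm2 : MemLp (fun s => w.val s 0) 2 (volume.restrict (Ioo 0 T)) :=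
    (memLp_two_iff_integrable_sq ((w.continuousOn_trace.mono
      Ioo_subset_Icc_self).aestronglyMeasurable measurableSet_Ioo)).2 (w.integrable_trace_sq le_rfl)
  have n1 : eLpNorm (fun x => w.val t (δ⁻¹ * x)) 2 (volume.restrict (Ioi 0)) ≤
      ENNReal.ofReal (√A * ρ) := by
    refine eLpNorm_two_le hm1 (by positivity) ?_
    -- The Jacobian of `x = δ y` raises the slice bound from `δ⁴ A` to `δ⁵ A = ρ² A`.
    rw [integral_comp_mul_left_Ioi (fun x => w.val t x ^ 2) 0 hδi, mul_zero, inv_inv, smul_eq_mul,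
      mul_pow, Real.sq_sqrt hA0, hρ2]
    have := mul_le_mul_of_nonneg_left ((hb1 t ht).trans (mul_le_mul_of_nonneg_left hrhs
      (by norm_num))) hδ.le
    linarith
  have n2 : eLpNorm (fun s => w.val s 0) 2 (volume.restrict (Ioo 0 T)) ≤
      ENNReal.ofReal (√(k * A) * ρ) := by
    refine eLpNorm_two_le hm2 (by positivity) ?_
    rw [mul_pow, Real.sq_sqrt (by positivity), hρ2]
    -- Here the extra `δ` comes from dividing by the damping rate `1 / (2 δ k)`.
    have h3 := hb2.trans (mul_le_mul_of_nonneg_left hrhs zero_le_two)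
    rw [one_div, inv_mul_le_iff₀ (by positivity)] at h3
    linarith
  simp only [errorAt, hval, mul_zero]
  refine (add_le_add n1 n2).trans ?_
  rw [← ENNReal.ofReal_add (by positivity) (by positivity)]
  exact ENNReal.ofReal_le_ofReal (by linarith)

theorem IsViscousLayer.errorAt_eq {T : ℝ} (hT : 0 < T) {uw : ℝ → ℝ} {K J : ℝ}
    {u0 u1 u2 v0 v1 v2 : ParabolicFunction T} (hu : IsViscousLayer T uw K J u0 u1 u2)
    (hv : IsViscousLayer T uw K J v0 v1 v2) (ε : ℝ) (u : ParabolicFunction T) {t : ℝ}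
    (ht : t ∈ Icc 0 T) : errorAt ε u u0 u1 u2 t = errorAt ε u v0 v1 v2 t := by
  have happ : ∀ s ∈ Icc 0 T, ∀ x ∈ Ici (0 : ℝ), approx ε u0 u1 u2 s x = approx ε v0 v1 v2 s x := by
    intro s hs x hx
    obtain ⟨h0, h1, h2⟩ := hu.unique hT hv s hs (x / √ε) (div_nonneg hx (Real.sqrt_nonneg _))
    simp only [approx, h0, h1, h2]
  rw [errorAt, errorAt]
  congr 1
  · refine eLpNorm_congr_ae ?_
    filter_upwards [ae_restrict_mem measurableSet_Ioi] with x hx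
    rw [happ t ht x (Ioi_subset_Ici_self hx)]
  · refine eLpNorm_congr_ae ?_
    filter_upwards [ae_restrict_mem measurableSet_Ioo] with s hs
    rw [happ s (Ioo_subset_Icc_self hs) 0 self_mem_Ici]

end Couette

/-! ### Uniform constant and the matching requirement -/

/-- Here `M = 2 * N + 1 ≥ 3` is the odd moment order.  The first part is the error estimate, the
second the matching requirement: the error is `o(ε)`. -/
theorem mainTheorem2 (N : ℕ) (hN : 1 ≤ N) (D : Couette.KnudsenDiagonalization N)
    (χ : ℝ) (hχ0 : 0 < χ) (hχ1 : χ ≤ 1) (T : ℝ) (hT : 0 < T)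
    (uw : ℝ → ℝ) (huw : ContDiffOn ℝ 1 uw (Icc 0 T)) (huw0 : uw 0 = 0) :
    (∃ C : ℝ, 0 < C ∧
      ∀ u0 u1 u2 : Couette.ParabolicFunction T,
        Couette.IsViscousLayer T uw (Couette.slipK D χ) (Couette.slipJ D χ) u0 u1 u2 →
      ∀ ε : ℝ, 0 < ε → ε ≤ 1 →
      ∀ u : Couette.ParabolicFunction T,
        Couette.IsNSSolution T uw (Couette.slipK D χ) (Couette.slipJ D χ) ε u →
      ∀ t ∈ Icc 0 T,
        Couette.errorAt ε u u0 u1 u2 t ≤ ENNReal.ofReal (C * ε ^ (5 / 4 : ℝ))) ∧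
    (∀ η : ℝ, 0 < η → ∃ ε₀ : ℝ, 0 < ε₀ ∧
      ∀ u0 u1 u2 : Couette.ParabolicFunction T,
        Couette.IsViscousLayer T uw (Couette.slipK D χ) (Couette.slipJ D χ) u0 u1 u2 →
      ∀ ε : ℝ, 0 < ε → ε < ε₀ →
      ∀ u : Couette.ParabolicFunction T,
        Couette.IsNSSolution T uw (Couette.slipK D χ) (Couette.slipJ D χ) ε u →
      ∀ t ∈ Icc 0 T,
        Couette.errorAt ε u u0 u1 u2 t ≤ ENNReal.ofReal (η * ε)) := by
  obtain ⟨C, hC, hmain⟩ : ∃ C : ℝ, 0 < C ∧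
      ∀ u0 u1 u2 : Couette.ParabolicFunction T,
        Couette.IsViscousLayer T uw (Couette.slipK D χ) (Couette.slipJ D χ) u0 u1 u2 →
      ∀ ε : ℝ, 0 < ε → ε ≤ 1 →
      ∀ u : Couette.ParabolicFunction T,
        Couette.IsNSSolution T uw (Couette.slipK D χ) (Couette.slipJ D χ) ε u →
      ∀ t ∈ Icc 0 T,
        Couette.errorAt ε u u0 u1 u2 t ≤ ENNReal.ofReal (C * ε ^ (5 / 4 : ℝ)) := by
    -- `C` must precede the layer: it is computed from one fixed layer and transferred to all others
    -- by uniqueness. If no layer exists, the claim is vacuous.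
    by_cases hex : ∃ v0 v1 v2 : Couette.ParabolicFunction T,
        Couette.IsViscousLayer T uw (Couette.slipK D χ) (Couette.slipJ D χ) v0 v1 v2
    · obtain ⟨v0, v1, v2, hv⟩ := hex
      obtain ⟨C, hC, h⟩ := hv.exists_error_bound hT (Couette.slipK_nonneg D hχ0 hχ1)
      refine ⟨C, hC, fun u0 u1 u2 hu ε hε hε1 u hns t ht => ?_⟩
      rw [hu.errorAt_eq hT hv ε u ht]
      exact h ε hε hε1 u hns t ht
    · exact ⟨1, one_pos, fun u0 u1 u2 hu => (hex ⟨u0, u1, u2, hu⟩).elim⟩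
  -- `C ε^{5/4} ≤ η ε` amounts to `ε^{1/4} ≤ η / C`, whence the fourth power; the `1` keeps `ε` in
  -- the range of the estimate.
  refine ⟨⟨C, hC, hmain⟩, fun η hη => ⟨min 1 ((η / C) ^ 4), by positivity, ?_⟩⟩
  intro u0 u1 u2 hu ε hε hlt u hns t ht
  refine (hmain u0 u1 u2 hu ε hε (hlt.le.trans (min_le_left _ _)) u hns t ht).trans
    (ENNReal.ofReal_le_ofReal ?_)
  have h1 : ε ^ (1 / 4 : ℝ) ≤ η / C := by
    have h2 := Real.rpow_le_rpow hε.le (hlt.le.trans (min_le_right _ _))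
      (by norm_num : (0 : ℝ) ≤ 1 / 4)
    rwa [← Real.rpow_natCast, ← Real.rpow_mul (by positivity), show ((4 : ℕ) : ℝ) * (1 / 4) = 1 by
      norm_num, Real.rpow_one] at h2
  have h3 : ε ^ (5 / 4 : ℝ) = ε * ε ^ (1 / 4 : ℝ) := by
    rw [← Real.rpow_one_add' hε.le (by norm_num)]
    norm_num
  rw [h3, mul_left_comm, mul_comm η]
  exact mul_le_mul_of_nonneg_left (by rwa [le_div_iff₀' hC] at h1) hε.le
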